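/- **Setting.** Let $\mathcal E=\bigoplus_{j=1}^m\mathcal E_j$ be an orthogonal sum of finite-dimensional Euclidean spaces and let $G\subset\mathcal E$ be compact. Let $\mathbb I$ be a finite index set, let $M_i\subset\{1,\dots,m\}$ be nonempty for $i\in\mathbb I$, let $T'_j:\mathcal E\to\mathcal E_j$, and let $T_i$ be given by $[T_i(x)]_j=T'_j(x)$ for $j\in M_i$ and $[T_i(x)]_j=x_j$ otherwise. Assume that $T_i(G)\subset G$ for every $i$ and that $(x,i)\mapsto T_ix$ is measurable on $G\times\mathbb I$. Let $\xi_0,\xi_1,\dots$ be i.i.d. $\mathbb I$-valued random variables (distributed as $\xi$), let $X_0$ be a $G$-valued random variable independent of $(\xi_k)$, let $X_{k+1}=T_{\xi_k}X_k$, and let $\mu_k$ be the law of $X_k$. Let $\mathcal P$ be the Markov operator $(\mu\mathcal P)(A)=\int_G\mathbb P(T_\xi x\in A)\,\mu(dx)$ and $\operatorname{inv}\mathcal P=\{\pi\in\mathscr P(G):\pi\mathcal P=\pi\}$. Let $p_j=\mathbb P(j\in M_\xi)$, assume $p_j>0$ for all $j$, and let $\|z\|_{\mathbf p}=\big(\sum_j\tfrac1{p_j}\|z_j\|^2\big)^{1/2}$.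 Let $\mathscr P_2(G)$ be the set of probability measures $\mu$ on $G$ with $\int\|x-y\|_{\mathbf p}^2\,\mu(dy)<\infty$ for some $x\in G$, let $d$ be the Wasserstein 2-metric on it for the norm $\|\cdot\|_{\mathbf p}$, and let $d(\mu,\operatorname{inv}\mathcal P)=\inf_{\pi\in\operatorname{inv}\mathcal P}d(\mu,\pi)$. Let $C=\{x\in G:\mathbb P(x=T_\xi x)=1\}$. Assume that $\mathcal P$ is a paracontraction with respect to $d$: $\operatorname{inv}\mathcal P\neq\emptyset$ and $d(\mu\mathcal P,\pi)<d(\mu,\pi)$ for all $\pi\in\operatorname{inv}\mathcal P$ and all $\mu\in\mathscr P_2(G)\setminus\operatorname{inv}\mathcal P$. Let $\mu_0\in\mathscr P_2(G)$ and $t_0=d(\mu_0,\operatorname{inv}\mathcal P)$. Let $\theta:[0,\infty)\to[0,\infty)$ be continuous with $\theta(0)=0$, and let $\bar t>t_0$ be such that $0<\theta(t)\le t$ for all $t\in(0,\bar t)$. Assume that $(\mu_k)$ is gauge monotone relative to $\operatorname{inv}\mathcal P$ with rate $\theta$: $$d(\mu_{k+1},\operatorname{inv}\mathcal P)\le\theta\big(d(\mu_k,\operatorname{inv}\mathcal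 P)\big)\quad\text{for all }k\in\mathbb N .$$ Assume that at least one of the following holds, where $\theta^{(k)}$ is the $k$-fold composition of $\theta$: (a) $\theta^{(k)}(t)\to0$ as $k\to\infty$ for all $t\in(0,\bar t)$, and $d(\mu_{k+1},\pi)\le d(\mu_k,\pi)$ for all $k\in\mathbb N$ and all $\pi\in\operatorname{inv}\mathcal P\cap\mathscr P_2(G)$; (b) $\sum_{j=1}^\infty\theta^{(j)}(t)<\infty$ for all $t\in(0,\bar t)$. **Conclusion.** There is $\pi^{\mu_0}\in\operatorname{inv}\mathcal P\cap\mathscr P_2(G)$ to which $(\mu_k)$ converges gauge monotonically, that is, $d(\mu_k,\pi^{\mu_0})\to0$ and $(\mu_k)$ is gauge monotone relative to $\operatorname{inv}\mathcal P$ with rate $\theta$. If $\theta$ is nondecreasing on $[0,t_0]$, then $d(\mu_k,\pi^{\mu_0})=O(\theta^{(k)}(t_0))$ in case (a), and $d(\mu_k,\pi^{\mu_0})=O(s_k(t_0))$ with $s_k(t)=\sum_{j=k}^\infty\theta^{(j)}(t)$ in case (b). Moreover, if $C\neq\emptyset$ (consistency), then $\operatorname{supp}\pi^{\mu_0}\subset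 C$. -/

import Mathlib

open MeasureTheory ProbabilityTheory Filter Topology
open scoped ENNReal NNReal

/-- The blockwise mapping `T_i` with `[T_i x]_j = T'_j x` if `j ∈ M_i` and `[T_i x]_j = x_j` otherwise,
on the Euclidean space `𝓔 = ⨁_j 𝓔_j`. -/
noncomputable def blockUpdate {m : ℕ} {E : Fin m → Type*} {I : Type*}
    (M : I → Finset (Fin m)) (T' : ∀ j, PiLp 2 E → E j) (i : I) (x : PiLp 2 E) : PiLp 2 E :=
  WithLp.toLp 2 (fun j => if j ∈ M i then T' j x else x j)

/-- The deterministic data of a stochastic block iteration on `G ⊆ 𝓔`: a nonempty set of blocks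
`M_i` for every index `i`, and the block actions `T'_j : 𝓔 → 𝓔_j`, such that the `T_i` are
self-mappings of `G` and the update function `(x, i) ↦ T_i x` is measurable on `G × I`. -/
structure BlockSystem {m : ℕ} (E : Fin m → Type*) [∀ j, NormedAddCommGroup (E j)]
    [∀ j, MeasurableSpace (E j)] (G : Set (PiLp 2 E)) (I : Type*) [MeasurableSpace I] where
  M : I → Finset (Fin m)
  M_nonempty : ∀ i, (M i).Nonempty
  T' : ∀ j, PiLp 2 E → E j
  mapsTo : ∀ i, Set.MapsTo (blockUpdate M T' i) G G
  measurable_update : Measurable (fun z : G × I => blockUpdate M T' z.2 (z.1 : PiLp 2 E))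

/-- The Euclidean norm with weights `1 / p_j`:
`‖z‖_p = (∑_j (1 / p_j) ‖z_j‖ ^ 2) ^ (1 / 2)`. -/
noncomputable def weightedNorm {m : ℕ} {E : Fin m → Type*} [∀ j, NormedAddCommGroup (E j)]
    (p : Fin m → ℝ) (z : PiLp 2 E) : ℝ :=
  Real.sqrt (∑ j, 1 / p j * ‖z j‖ ^ 2)

section Wasserstein

variable {m : ℕ} {E : Fin m → Type*} [∀ j, NormedAddCommGroup (E j)]
  [∀ j, MeasurableSpace (E j)] {G : Set (PiLp 2 E)}

/-- The probability measures on `G` with finite second moment. -/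
def secondMomentMeasures (p : Fin m → ℝ) : Set (ProbabilityMeasure G) :=
  {μ | ∃ x : G, ∫⁻ y : G, ENNReal.ofReal (weightedNorm p ((x : PiLp 2 E) - (y : PiLp 2 E)) ^ 2)
    ∂(μ : Measure G) < ∞}

/-- The couplings of `μ` and `ν`. -/
def couplings (μ ν : ProbabilityMeasure G) : Set (ProbabilityMeasure (G × G)) :=
  {γ | (γ : Measure (G × G)).map Prod.fst = μ ∧ (γ : Measure (G × G)).map Prod.snd = ν}

/-- The Wasserstein 2-distance with respect to the weighted norm, with values in `[0, ∞]`
(it is finite between measures with finite second moment). -/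
noncomputable def wasserstein (p : Fin m → ℝ) (μ ν : ProbabilityMeasure G) : ℝ≥0∞ :=
  (⨅ γ ∈ couplings μ ν, ∫⁻ z : G × G,
    ENNReal.ofReal (weightedNorm p ((z.1 : PiLp 2 E) - (z.2 : PiLp 2 E)) ^ 2)
      ∂(γ : Measure (G × G))) ^ (1 / 2 : ℝ)

/-- The distance of a measure to a set of measures (`∞` if the set is empty). -/
noncomputable def wassersteinInf (p : Fin m → ℝ) (μ : ProbabilityMeasure G)
    (S : Set (ProbabilityMeasure G)) : ℝ≥0∞ :=
  ⨅ π ∈ S, wasserstein p μ π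

end Wasserstein

namespace BlockSystem

variable {m : ℕ} {E : Fin m → Type*} [∀ j, NormedAddCommGroup (E j)]
  [∀ j, MeasurableSpace (E j)] {G : Set (PiLp 2 E)} {I : Type*} [MeasurableSpace I]

/-- `T_i` as a self-mapping of `G`. -/
noncomputable def T (B : BlockSystem E G I) (i : I) (x : G) : G :=
  ⟨blockUpdate B.M B.T' i x, B.mapsTo i x.2⟩

theorem measurable_T (B : BlockSystem E G I) : Measurable (fun z : G × I => B.T z.2 z.1) :=
  B.measurable_update.subtype_mk

/-- `p_j = ∑_i η_i χ_{M_i}(j)`, the probability that block `j` is among the selected blocks, where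
`η` is the law of the random index. -/
noncomputable def blockProb [Fintype I] (B : BlockSystem E G I) (η : Measure I) (j : Fin m) : ℝ :=
  ∑ i, η.real {i} * (if j ∈ B.M i then 1 else 0)

/-- The transition kernel `p(x, A) = ℙ(T_ξ x ∈ A)`, where `ξ` has law `η`. -/
noncomputable def kernel (B : BlockSystem E G I) (η : Measure I) [IsProbabilityMeasure η] :
    Kernel G G where
  toFun x := η.map (fun i => B.T i x)
  measurable' := by
    refine Measure.measurable_of_measurable_coe _ fun s hs => ?_
    have h : ∀ x : G, (η.map (fun i => B.T i x)) s
        = η (Prod.mk x ⁻¹' ((fun z : G × I => B.T z.2 z.1) ⁻¹' s)) := fun x =>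
      Measure.map_apply (B.measurable_T.comp measurable_prodMk_left) hs
    simp_rw [h]
    exact measurable_measure_prodMk_left (B.measurable_T hs)

instance (B : BlockSystem E G I) (η : Measure I) [IsProbabilityMeasure η] :
    IsMarkovKernel (B.kernel η) :=
  ⟨fun _ => Measure.isProbabilityMeasure_map
    (B.measurable_T.comp measurable_prodMk_left).aemeasurable⟩

/-- The Markov operator `μ ↦ μP`, `(μP)(A) = ∫ p(x, A) μ(dx)`. -/
noncomputable def markov (B : BlockSystem E G I) (η : Measure I) [IsProbabilityMeasure η]
    (μ : ProbabilityMeasure G) : ProbabilityMeasure G :=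
  ⟨(μ : Measure G).bind (B.kernel η), inferInstance⟩

/-- The set `inv P` of invariant probability measures. -/
def inv (B : BlockSystem E G I) (η : Measure I) [IsProbabilityMeasure η] :
    Set (ProbabilityMeasure G) :=
  {π | B.markov η π = π}

/-- The set `C = {x ∈ G | ℙ(x = T_ξ x) = 1}` of common fixed points. -/
def commonFix (B : BlockSystem E G I) (η : Measure I) : Set G :=
  {x | η {i | x = B.T i x} = 1}

/-- The Markov operator is a paracontraction in the weighted Wasserstein metric. -/
def IsParacontraction (B : BlockSystem E G I) (η : Measure I) [IsProbabilityMeasure η]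
    (p : Fin m → ℝ) : Prop :=
  (B.inv η).Nonempty ∧ ∀ π ∈ B.inv η, ∀ μ ∈ secondMomentMeasures p \ B.inv η,
    wasserstein p (B.markov η μ) π < wasserstein p μ π

/-- The iterates `X_{k+1} = T_{ξ_k} X_k` of the stochastic block iteration. -/
noncomputable def iterates {Ω : Type*} (B : BlockSystem E G I) (ξ : ℕ → Ω → I) (X₀ : Ω → G) :
    ℕ → Ω → G
  | 0 => X₀
  | k + 1 => fun ω => B.T (ξ k ω) (B.iterates ξ X₀ k ω)

end BlockSystem

/-- `θ : ℝ₊ → ℝ₊` is continuous with `θ 0 = 0` and `0 < θ t ≤ t` on `(0, tbar)`, where `tbar > 0`. -/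
def IsRate (θ : ℝ≥0 → ℝ≥0) (tbar : ℝ≥0) : Prop :=
  Continuous θ ∧ θ 0 = 0 ∧ 0 < tbar ∧ ∀ t, 0 < t → t < tbar → 0 < θ t ∧ θ t ≤ t

section Convergence

variable {m : ℕ} {E : Fin m → Type*} [∀ j, NormedAddCommGroup (E j)]
  [∀ j, MeasurableSpace (E j)] {G : Set (PiLp 2 E)}

/-- `(μ_k)` is gauge monotone relative to `S` with rate `θ`:
`d(μ_{k+1}, S) ≤ θ(d(μ_k, S))` for all `k`, where `θ` is a rate on `(0, tbar)` and
`t₀ = d(μ_0, S) < tbar`. -/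
def IsGaugeMonotone (p : Fin m → ℝ) (θ : ℝ≥0 → ℝ≥0) (tbar : ℝ≥0)
    (S : Set (ProbabilityMeasure G)) (μ : ℕ → ProbabilityMeasure G) : Prop :=
  IsRate θ tbar ∧ wassersteinInf p (μ 0) S < tbar ∧
    ∀ k, wassersteinInf p (μ (k + 1)) S ≤ θ (wassersteinInf p (μ k) S).toNNReal

/-- `(μ_k)` converges to `π` gauge monotonically (relative to `S`, with rate `θ`). -/
def ConvergesGaugeMonotonically (p : Fin m → ℝ) (θ : ℝ≥0 → ℝ≥0) (tbar : ℝ≥0)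
    (S : Set (ProbabilityMeasure G)) (μ : ℕ → ProbabilityMeasure G)
    (π : ProbabilityMeasure G) : Prop :=
  Tendsto (fun k => wasserstein p (μ k) π) atTop (𝓝 0) ∧ IsGaugeMonotone p θ tbar S μ

/-- Condition (a): the iterates of `θ` tend to zero on `(0, tbar)`, and `(μ_k)` is Fejér monotone
with respect to the measures in `S` with finite second moment. -/
def VanishingAndFejer (p : Fin m → ℝ) (θ : ℝ≥0 → ℝ≥0) (tbar : ℝ≥0)
    (S : Set (ProbabilityMeasure G)) (μ : ℕ → ProbabilityMeasure G) : Prop :=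
  (∀ t, 0 < t → t < tbar → Tendsto (fun k : ℕ => θ^[k] t) atTop (𝓝 0)) ∧
    ∀ k, ∀ π ∈ S ∩ secondMomentMeasures p,
      wasserstein p (μ (k + 1)) π ≤ wasserstein p (μ k) π

end Convergence

/-- Condition (b): the iterates of `θ` are summable on `(0, tbar)`. -/
def SummableIterates (θ : ℝ≥0 → ℝ≥0) (tbar : ℝ≥0) : Prop :=
  ∀ t, 0 < t → t < tbar → Summable (fun j : ℕ => θ^[j + 1] t)

/-! Since `G` is compact, every law on `G` has finite second moment and the space of laws is weakly
compact. The paracontraction property makes `μ k` Fejér monotone with respect to every invariant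
`ν`, so for `l ≥ k` the triangle inequality through `ν` gives `W(μ k, μ l) ≤ 2 W(μ k, ν)`. Taking
the infimum over `ν` and a weak cluster point `π` in `l`, lower semicontinuity of `W` yields `W(μ k,
π) ≤ 2 d(μ k, inv P)` (`exists_wasserstein_le_of_fejer`).

Gauge monotonicity drives `d(μ k, inv P)` to zero (`IsRate.tendsto_zero_of_le`) and, for monotone
`θ`, bounds it by the iterates of `θ` (`IsRate.le_iterate`). Hence `μ k → π` with the stated rates
and `d(π, inv P) = 0`, so `π` is invariant (`IsParacontraction.mem_inv`).

For the support, compare Dirac masses with a common fixed point `x`: one step strictly lowers the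
mean squared distance to `x` from any point outside `C`, while invariance of `π` forbids a loss on
average. So `π` lives on `C`, which is closed. -/

/-! ### The weighted norm and its distance -/

section WeightedDistance

variable {m : ℕ} {E : Fin m → Type*} [∀ j, NormedAddCommGroup (E j)]

theorem weightedNorm_nonneg (p : Fin m → ℝ) (z : PiLp 2 E) : 0 ≤ weightedNorm p z :=
  Real.sqrt_nonneg _

theorem weightedNorm_neg (p : Fin m → ℝ) (z : PiLp 2 E) :
    weightedNorm p (-z) = weightedNorm p z := by
  simp [weightedNorm]

theorem weightedNorm_eq_norm {p : Fin m → ℝ} (hp : ∀ j, 0 < p j) (z : PiLp 2 E) :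
    weightedNorm p z =
      ‖(WithLp.toLp 2 fun j => Real.sqrt (1 / p j) * ‖z j‖ : EuclideanSpace ℝ (Fin m))‖ := by
  rw [EuclideanSpace.norm_eq, weightedNorm]
  congr 1
  refine Finset.sum_congr rfl fun j _ => ?_
  have h : 0 ≤ 1 / p j := (one_div_pos.2 (hp j)).le
  simp only [Real.norm_eq_abs, sq_abs, mul_pow, Real.sq_sqrt h]

theorem weightedNorm_add_le {p : Fin m → ℝ} (hp : ∀ j, 0 < p j) (z w : PiLp 2 E) :
    weightedNorm p (z + w) ≤ weightedNorm p z + weightedNorm p w := by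
  have h : weightedNorm p (z + w) ≤
      ‖(WithLp.toLp 2 fun j => Real.sqrt (1 / p j) * ‖z j‖ : EuclideanSpace ℝ (Fin m)) +
        (WithLp.toLp 2 fun j => Real.sqrt (1 / p j) * ‖w j‖ : EuclideanSpace ℝ (Fin m))‖ := by
    rw [EuclideanSpace.norm_eq, weightedNorm]
    refine Real.sqrt_le_sqrt (Finset.sum_le_sum fun j _ => ?_)
    have h : 0 ≤ 1 / p j := (one_div_pos.2 (hp j)).le
    simp only [PiLp.add_apply, Real.norm_eq_abs, sq_abs, ← mul_add, mul_pow, Real.sq_sqrt h]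
    gcongr
    exact norm_add_le _ _
  rw [weightedNorm_eq_norm hp z, weightedNorm_eq_norm hp w]
  exact h.trans (norm_add_le _ _)

theorem weightedNorm_eq_zero {p : Fin m → ℝ} (hp : ∀ j, 0 < p j) {z : PiLp 2 E} :
    weightedNorm p z = 0 ↔ z = 0 := by
  rw [weightedNorm_eq_norm hp, norm_eq_zero]
  constructor
  · intro h
    ext j
    have hj := congrArg (fun v : EuclideanSpace ℝ (Fin m) => v j) h
    have hs : Real.sqrt (1 / p j) ≠ 0 := (Real.sqrt_pos.2 (one_div_pos.2 (hp j))).ne'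
    simpa [(hp j).ne', hs, (Real.sqrt_pos.2 (hp j)).ne'] using hj
  · rintro rfl
    ext j
    simp

theorem continuous_weightedNorm (p : Fin m → ℝ) :
    Continuous (weightedNorm p : PiLp 2 E → ℝ) := by
  unfold weightedNorm
  fun_prop

variable {G : Set (PiLp 2 E)}

/-- The distance induced by the weighted norm, with values in `[0, ∞]`. -/
noncomputable def weightedEDist (p : Fin m → ℝ) (x y : G) : ℝ≥0∞ :=
  ENNReal.ofReal (weightedNorm p ((x : PiLp 2 E) - (y : PiLp 2 E)))

theorem ofReal_weightedNorm_sq (p : Fin m → ℝ) (x y : G) :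
    ENNReal.ofReal (weightedNorm p ((x : PiLp 2 E) - (y : PiLp 2 E)) ^ 2) =
      weightedEDist p x y ^ (2 : ℝ) := by
  rw [weightedEDist, ENNReal.ofReal_pow (weightedNorm_nonneg _ _)]
  norm_cast

theorem weightedEDist_comm (p : Fin m → ℝ) (x y : G) :
    weightedEDist p x y = weightedEDist p y x := by
  rw [weightedEDist, weightedEDist, ← weightedNorm_neg, neg_sub]

theorem weightedEDist_triangle {p : Fin m → ℝ} (hp : ∀ j, 0 < p j) (x y z : G) :
    weightedEDist p x z ≤ weightedEDist p x y + weightedEDist p y z := by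
  rw [weightedEDist, weightedEDist, weightedEDist,
    ← ENNReal.ofReal_add (weightedNorm_nonneg _ _) (weightedNorm_nonneg _ _)]
  refine ENNReal.ofReal_le_ofReal ?_
  simpa using weightedNorm_add_le hp ((x : PiLp 2 E) - (y : PiLp 2 E)) ((y : PiLp 2 E) - (z : PiLp 2 E))

theorem weightedEDist_eq_zero {p : Fin m → ℝ} (hp : ∀ j, 0 < p j) {x y : G} :
    weightedEDist p x y = 0 ↔ x = y := by
  rw [weightedEDist, ENNReal.ofReal_eq_zero, (weightedNorm_nonneg _ _).ge_iff_eq',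
    weightedNorm_eq_zero hp, sub_eq_zero, Subtype.ext_iff]

theorem weightedEDist_ne_top (p : Fin m → ℝ) (x y : G) : weightedEDist p x y ≠ ∞ :=
  ENNReal.ofReal_ne_top

theorem continuous_weightedEDist (p : Fin m → ℝ) :
    Continuous fun z : G × G => weightedEDist p z.1 z.2 := by
  unfold weightedEDist
  exact ENNReal.continuous_ofReal.comp ((continuous_weightedNorm p).comp (by fun_prop))

end WeightedDistance

/-! ### Couplings and the Wasserstein distance -/

section Couplings

theorem tendsto_lintegral_of_continuous {X ι : Type*} [TopologicalSpace X] [CompactSpace X]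
    [MeasurableSpace X] [OpensMeasurableSpace X] {F : Filter ι} {γs : ι → ProbabilityMeasure X}
    {γ : ProbabilityMeasure X} (hγ : Tendsto γs F (𝓝 γ)) {f : X → ℝ≥0∞} (hf : Continuous f)
    (hf' : ∀ x, f x ≠ ∞) :
    Tendsto (fun i => ∫⁻ x, f x ∂(γs i : Measure X)) F (𝓝 (∫⁻ x, f x ∂(γ : Measure X))) := by
  have hc : Continuous fun x => (f x).toNNReal :=
    ENNReal.continuousOn_toNNReal.comp_continuous hf hf'
  have h := ProbabilityMeasure.tendsto_iff_forall_lintegral_tendsto.1 hγ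
    (BoundedContinuousFunction.mkOfCompact ⟨_, hc⟩)
  simpa [ENNReal.coe_toNNReal (hf' _)] using h

variable {m : ℕ} {E : Fin m → Type*} [∀ j, NormedAddCommGroup (E j)]
  [∀ j, MeasurableSpace (E j)] {G : Set (PiLp 2 E)}

/-- The power `1 / 2` is an order isomorphism of `[0, ∞]`, so it passes inside the infimum; this is
the form to which Minkowski's inequality applies. -/
theorem wasserstein_eq (p : Fin m → ℝ) (μ ν : ProbabilityMeasure G) :
    wasserstein p μ ν = ⨅ γ ∈ couplings μ ν,
      (∫⁻ z : G × G, weightedEDist p z.1 z.2 ^ (2 : ℝ) ∂(γ : Measure (G × G))) ^ (1 / 2 : ℝ) := by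
  simp only [wasserstein, ofReal_weightedNorm_sq]
  exact (ENNReal.orderIsoRpow (1 / 2 : ℝ) (by norm_num)).map_iInf₂
    fun (γ : ProbabilityMeasure (G × G)) (_ : γ ∈ couplings μ ν) =>
      ∫⁻ z : G × G, weightedEDist p z.1 z.2 ^ (2 : ℝ) ∂(γ : Measure (G × G))

theorem wasserstein_le (p : Fin m → ℝ) {μ ν : ProbabilityMeasure G}
    {γ : ProbabilityMeasure (G × G)} (hγ : γ ∈ couplings μ ν) :
    wasserstein p μ ν ≤
      (∫⁻ z : G × G, weightedEDist p z.1 z.2 ^ (2 : ℝ) ∂(γ : Measure (G × G))) ^ (1 / 2 : ℝ) := by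
  rw [wasserstein_eq]
  exact iInf₂_le γ hγ

omit [∀ j, NormedAddCommGroup (E j)] in
theorem map_swap_mem_couplings {μ ν : ProbabilityMeasure G} {γ : ProbabilityMeasure (G × G)}
    (hγ : γ ∈ couplings μ ν) :
    γ.map measurable_swap.aemeasurable ∈ couplings ν μ := by
  simp only [couplings, Set.mem_ofPred_eq, ProbabilityMeasure.toMeasure_map] at hγ ⊢
  rw [Measure.map_map measurable_fst measurable_swap, Measure.map_map measurable_snd measurable_swap]
  exact ⟨hγ.2, hγ.1⟩

variable [∀ j, BorelSpace (E j)] [∀ j, SecondCountableTopology (E j)]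

theorem measurable_weightedEDist (p : Fin m → ℝ) :
    Measurable fun z : G × G => weightedEDist p z.1 z.2 :=
  (continuous_weightedEDist p).measurable

theorem wasserstein_comm (p : Fin m → ℝ) (μ ν : ProbabilityMeasure G) :
    wasserstein p μ ν = wasserstein p ν μ := by
  have key : ∀ μ ν : ProbabilityMeasure G, wasserstein p μ ν ≤ wasserstein p ν μ := by
    intro μ ν
    rw [wasserstein_eq p ν μ]
    refine le_iInf₂ fun γ hγ => (wasserstein_le p (map_swap_mem_couplings hγ)).trans_eq ?_
    rw [ProbabilityMeasure.toMeasure_map,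
      lintegral_map ((measurable_weightedEDist p).pow_const _) measurable_swap]
    simp [weightedEDist_comm p]
  exact le_antisymm (key μ ν) (key ν μ)

theorem mem_couplings_of_tendsto [CompactSpace G] {ι : Type*} {F : Filter ι} [F.NeBot]
    {μs νs : ι → ProbabilityMeasure G} {μ ν : ProbabilityMeasure G}
    (hμ : Tendsto μs F (𝓝 μ)) (hν : Tendsto νs F (𝓝 ν)) {γs : ι → ProbabilityMeasure (G × G)}
    {γ : ProbabilityMeasure (G × G)} (hγs : ∀ᶠ i in F, γs i ∈ couplings (μs i) (νs i))
    (hγ : Tendsto γs F (𝓝 γ)) : γ ∈ couplings μ ν := by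
  have h1 : γ.map measurable_fst.aemeasurable = μ := by
    refine tendsto_nhds_unique
      (((ProbabilityMeasure.continuous_map continuous_fst).tendsto γ).comp hγ) (hμ.congr' ?_)
    filter_upwards [hγs] with i hi
    exact Subtype.ext hi.1.symm
  have h2 : γ.map measurable_snd.aemeasurable = ν := by
    refine tendsto_nhds_unique
      (((ProbabilityMeasure.continuous_map continuous_snd).tendsto γ).comp hγ) (hν.congr' ?_)
    filter_upwards [hγs] with i hi
    exact Subtype.ext hi.2.symm
  exact ⟨congrArg Subtype.val h1, congrArg Subtype.val h2⟩

/-- The Wasserstein distance is lower semicontinuous under weak convergence, and bounds are attained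
by couplings of the limits. -/
theorem exists_coupling_of_tendsto [CompactSpace G] (p : Fin m → ℝ) {ι : Type*} {F : Filter ι}
    [F.NeBot] {μs νs : ι → ProbabilityMeasure G} {μ ν : ProbabilityMeasure G}
    (hμ : Tendsto μs F (𝓝 μ)) (hν : Tendsto νs F (𝓝 ν)) {rs : ι → ℝ≥0∞} {r : ℝ≥0∞}
    (hr : ∀ᶠ i in F, wasserstein p (μs i) (νs i) < rs i) (hrs : Tendsto rs F (𝓝 r)) :
    ∃ γ ∈ couplings μ ν, (∫⁻ z : G × G, weightedEDist p z.1 z.2 ^ (2 : ℝ)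
      ∂(γ : Measure (G × G))) ^ (1 / 2 : ℝ) ≤ r := by
  have hex : ∀ᶠ i in F, ∃ γ : ProbabilityMeasure (G × G), γ ∈ couplings (μs i) (νs i) ∧
      (∫⁻ z : G × G, weightedEDist p z.1 z.2 ^ (2 : ℝ) ∂(γ : Measure (G × G))) ^ (1 / 2 : ℝ)
        < rs i := by
    filter_upwards [hr] with i hi
    rw [wasserstein_eq] at hi
    simpa only [iInf_lt_iff, exists_prop] using hi
  have : Nonempty (ProbabilityMeasure (G × G)) := hex.exists.elim fun _ h => h.nonempty
  obtain ⟨γs, hγs⟩ := hex.choice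
  -- An ultrafilter finer than `F` replaces the choice of a subsequence of near-optimal couplings.
  have hU : (Ultrafilter.of F : Filter ι) ≤ F := Ultrafilter.of_le F
  obtain ⟨γ, -, hγ⟩ := isCompact_univ.ultrafilter_le_nhds ((Ultrafilter.of F).map γs) (by simp)
  have hγ : Tendsto γs (Ultrafilter.of F) (𝓝 γ) := hγ
  refine ⟨γ, mem_couplings_of_tendsto (hμ.mono_left hU) (hν.mono_left hU)
    ((hγs.filter_mono hU).mono fun i hi => hi.1) hγ, ?_⟩
  have hint := tendsto_lintegral_of_continuous hγ
    (ENNReal.continuous_rpow_const.comp (continuous_weightedEDist p) :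
      Continuous fun z : G × G => weightedEDist p z.1 z.2 ^ (2 : ℝ))
    fun z => ENNReal.rpow_ne_top_of_nonneg (by norm_num) (weightedEDist_ne_top p z.1 z.2)
  exact le_of_tendsto_of_tendsto ((ENNReal.continuous_rpow_const.tendsto _).comp hint)
    (hrs.mono_left hU) ((hγs.filter_mono hU).mono fun i hi => hi.2.le)

theorem wasserstein_le_of_tendsto [CompactSpace G] (p : Fin m → ℝ) {ι : Type*} {F : Filter ι}
    [F.NeBot] {μ : ProbabilityMeasure G} {νs : ι → ProbabilityMeasure G} {ν : ProbabilityMeasure G}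
    (hν : Tendsto νs F (𝓝 ν)) {r : ℝ≥0∞} (hr : ∀ᶠ i in F, wasserstein p μ (νs i) ≤ r) :
    wasserstein p μ ν ≤ r := by
  refine le_of_forall_gt fun s hs => ?_
  obtain ⟨t, hrt, hts⟩ := exists_between hs
  obtain ⟨γ, hγ, h⟩ := exists_coupling_of_tendsto p (tendsto_const_nhds (x := μ)) hν
    (rs := fun _ => t) (hr.mono fun i hi => hi.trans_lt hrt) tendsto_const_nhds
  exact ((wasserstein_le p hγ).trans h).trans_lt hts

theorem eq_of_wasserstein_eq_zero [CompactSpace G] {p : Fin m → ℝ} (hp : ∀ j, 0 < p j)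
    {μ ν : ProbabilityMeasure G} (h : wasserstein p μ ν = 0) : μ = ν := by
  -- Strict bounds `r > 0` tending to `0` give in the limit a coupling of zero cost, which sits on
  -- the diagonal.
  obtain ⟨γ, hγ, h0⟩ := exists_coupling_of_tendsto p (F := 𝓝[>] (0 : ℝ≥0∞))
    (tendsto_const_nhds (x := μ)) (tendsto_const_nhds (x := ν)) (rs := id) (r := 0)
    (by rw [h]; exact self_mem_nhdsWithin) (tendsto_id'.2 nhdsWithin_le_nhds)
  have h0 : ∫⁻ z : G × G, weightedEDist p z.1 z.2 ^ (2 : ℝ) ∂(γ : Measure (G × G)) = 0 := by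
    rwa [nonpos_iff_eq_zero, ENNReal.rpow_eq_zero_iff_of_pos (by norm_num)] at h0
  rw [lintegral_eq_zero_iff ((measurable_weightedEDist p).pow_const _)] at h0
  refine Subtype.ext (hγ.1.symm.trans ((Measure.map_congr ?_).trans hγ.2))
  filter_upwards [h0] with z hz
  simpa [weightedEDist_eq_zero hp] using hz

/-- Gluing of couplings along the common marginal. -/
theorem exists_gluing [CompactSpace G] {μ ν ρ : ProbabilityMeasure G}
    {γ₁ γ₂ : ProbabilityMeasure (G × G)} (h₁ : γ₁ ∈ couplings μ ν) (h₂ : γ₂ ∈ couplings ν ρ) :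
    ∃ τ : Measure (G × G × G), τ.map (fun z => (z.2.1, z.1)) = γ₁ ∧
      τ.map (fun z => (z.1, z.2.2)) = γ₂ := by
  have : Nonempty G := ν.nonempty
  set γ₁' := γ₁.map (f := Prod.swap) measurable_swap.aemeasurable with hγ₁'
  have h₁' : γ₁' ∈ couplings ν μ := map_swap_mem_couplings h₁
  have e₁ : (ν : Measure G) ⊗ₘ (γ₁' : Measure (G × G)).condKernel = γ₁' := by
    have := (γ₁' : Measure (G × G)).disintegrate (γ₁' : Measure (G × G)).condKernel
    rwa [Measure.fst, h₁'.1] at this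
  have e₂ : (ν : Measure G) ⊗ₘ (γ₂ : Measure (G × G)).condKernel = γ₂ := by
    have := (γ₂ : Measure (G × G)).disintegrate (γ₂ : Measure (G × G)).condKernel
    rwa [Measure.fst, h₂.1] at this
  -- The common marginal is the first coordinate; given it, the other two are drawn independently.
  refine ⟨(ν : Measure G) ⊗ₘ ((γ₁' : Measure (G × G)).condKernel ×ₖ
    (γ₂ : Measure (G × G)).condKernel), ?_, ?_⟩
  · have : (γ₁ : Measure (G × G)) = (γ₁' : Measure (G × G)).map Prod.swap := by
      rw [hγ₁', ProbabilityMeasure.toMeasure_map, Measure.map_map measurable_swap measurable_swap]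
      simp
    rw [this]
    conv_rhs => rw [← e₁]
    refine Measure.ext_of_lintegral _ fun f hf => ?_
    rw [lintegral_map hf (by fun_prop), lintegral_map hf measurable_swap,
      Measure.lintegral_compProd (by fun_prop), Measure.lintegral_compProd (by fun_prop)]
    refine lintegral_congr fun x => ?_
    rw [Kernel.lintegral_prod _ _ _ (by fun_prop)]
    simp
  · conv_rhs => rw [← e₂]
    refine Measure.ext_of_lintegral _ fun f hf => ?_
    rw [lintegral_map hf (by fun_prop),
      Measure.lintegral_compProd (by fun_prop), Measure.lintegral_compProd (by fun_prop)]
    refine lintegral_congr fun x => ?_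
    rw [Kernel.lintegral_prod _ _ _ (by fun_prop)]
    simp

/-- Minkowski's inequality in `L²` of a glued measure. -/
theorem wasserstein_triangle [CompactSpace G] {p : Fin m → ℝ} (hp : ∀ j, 0 < p j)
    (μ ν ρ : ProbabilityMeasure G) :
    wasserstein p μ ρ ≤ wasserstein p μ ν + wasserstein p ν ρ := by
  rw [wasserstein_eq p μ ν, wasserstein_eq p ν ρ]
  refine ENNReal.le_iInf₂_add_iInf₂ fun γ₁ h₁ γ₂ h₂ => ?_
  obtain ⟨τ, hτ₁, hτ₂⟩ := exists_gluing h₁ h₂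
  have hm₁ : Measurable fun z : G × G × G => (z.2.1, z.1) := by fun_prop
  have hm₂ : Measurable fun z : G × G × G => (z.1, z.2.2) := by fun_prop
  have hm₃ : Measurable fun z : G × G × G => (z.2.1, z.2.2) := by fun_prop
  have hτ : IsProbabilityMeasure τ := by
    have : IsProbabilityMeasure (τ.map fun z => (z.2.1, z.1)) := hτ₁ ▸ inferInstance
    exact Measure.isProbabilityMeasure_of_map (fun z : G × G × G => (z.2.1, z.1))
  have hD := measurable_weightedEDist p (G := G)
  obtain ⟨τ, rfl⟩ : ∃ τ' : ProbabilityMeasure (G × G × G), (τ' : Measure (G × G × G)) = τ :=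
    ⟨⟨τ, hτ⟩, rfl⟩
  have hγ : τ.map hm₃.aemeasurable ∈ couplings μ ρ := by
    simp only [couplings, Set.mem_ofPred_eq, ProbabilityMeasure.toMeasure_map]
    rw [Measure.map_map measurable_fst hm₃, Measure.map_map measurable_snd hm₃, ← h₁.1, ← h₂.2,
      ← hτ₁, ← hτ₂, Measure.map_map measurable_fst hm₁, Measure.map_map measurable_snd hm₂]
    exact ⟨rfl, rfl⟩
  refine (wasserstein_le p hγ).trans ?_
  rw [ProbabilityMeasure.toMeasure_map, ← hτ₁, ← hτ₂,
    lintegral_map (hD.pow_const _) hm₁, lintegral_map (hD.pow_const _) hm₂,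
    lintegral_map (hD.pow_const _) hm₃]
  refine le_trans ?_ (ENNReal.lintegral_Lp_add_le (μ := (τ : Measure (G × G × G))) (hD.comp hm₁).aemeasurable
    (hD.comp hm₂).aemeasurable one_le_two)
  refine ENNReal.rpow_le_rpow (lintegral_mono fun z => ?_) (by norm_num)
  exact ENNReal.rpow_le_rpow (weightedEDist_triangle hp _ _ _) (by norm_num)

omit [∀ j, BorelSpace (E j)] [∀ j, SecondCountableTopology (E j)] in
theorem lintegral_weightedEDist_ne_top [CompactSpace G] (p : Fin m → ℝ) (x : G) (μ : Measure G)
    [IsFiniteMeasure μ] : ∫⁻ y, weightedEDist p y x ^ (2 : ℝ) ∂μ ≠ ∞ := by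
  have hd : Continuous fun y : G => weightedEDist p y x :=
    Continuous.comp (g := fun z : G × G => weightedEDist p z.1 z.2) (f := fun y : G => (y, x))
      (continuous_weightedEDist p) (by fun_prop)
  have hc : Continuous fun y : G => weightedEDist p y x ^ (2 : ℝ) :=
    (ENNReal.continuous_rpow_const (y := 2)).comp hd
  obtain ⟨z, -, hz⟩ := isCompact_univ.exists_isMaxOn ⟨x, Set.mem_univ x⟩ hc.continuousOn
  have hb : ∫⁻ y, weightedEDist p y x ^ (2 : ℝ) ∂μ ≤ ∫⁻ _, weightedEDist p z x ^ (2 : ℝ) ∂μ :=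
    lintegral_mono fun y => hz (Set.mem_univ y)
  rw [lintegral_const] at hb
  have hz' : weightedEDist p z x ^ (2 : ℝ) ≠ ∞ :=
    ENNReal.rpow_ne_top_of_nonneg (by norm_num) (weightedEDist_ne_top p z x)
  exact ne_top_of_le_ne_top (ENNReal.mul_ne_top hz' (measure_ne_top _ _)) hb

omit [∀ j, BorelSpace (E j)] [∀ j, SecondCountableTopology (E j)] in
theorem mem_secondMomentMeasures [CompactSpace G] (p : Fin m → ℝ) (μ : ProbabilityMeasure G) :
    μ ∈ secondMomentMeasures p := by
  obtain ⟨x⟩ := μ.nonempty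
  refine ⟨x, lt_top_iff_ne_top.2 ?_⟩
  simp only [ofReal_weightedNorm_sq, weightedEDist_comm p x]
  exact lintegral_weightedEDist_ne_top p x μ

/-- The Dirac measure as a probability measure. -/
noncomputable def diracProbability {X : Type*} [MeasurableSpace X] (x : X) :
    ProbabilityMeasure X :=
  ⟨Measure.dirac x, inferInstance⟩

/-- Every coupling with a Dirac mass is concentrated on `z.2 = x`, so all couplings have the same
cost. -/
theorem wasserstein_dirac (p : Fin m → ℝ) (μ : ProbabilityMeasure G) (x : G) :
    wasserstein p μ (diracProbability x) =
      (∫⁻ y, weightedEDist p y x ^ (2 : ℝ) ∂(μ : Measure G)) ^ (1 / 2 : ℝ) := by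
  have hD := measurable_weightedEDist p (G := G)
  have hx : Measurable fun y : G => (y, x) := by fun_prop
  refine le_antisymm ?_ ?_
  · have hγ : μ.map hx.aemeasurable ∈ couplings μ (diracProbability x) := by
      simp only [couplings, Set.mem_ofPred_eq, ProbabilityMeasure.toMeasure_map]
      rw [Measure.map_map measurable_fst hx, Measure.map_map measurable_snd hx]
      refine ⟨Measure.map_id, ?_⟩
      change (μ : Measure G).map (fun _ => x) = Measure.dirac x
      simp
    refine (wasserstein_le p hγ).trans_eq ?_
    rw [ProbabilityMeasure.toMeasure_map, lintegral_map (hD.pow_const _) hx]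
  · rw [wasserstein_eq]
    refine le_iInf₂ fun γ hγ => le_of_eq ?_
    congr 1
    have hs : ∀ᵐ z ∂(γ : Measure (G × G)), z.2 = x := by
      have h : ∀ᵐ y ∂((γ : Measure (G × G)).map Prod.snd), y = x := by
        rw [hγ.2]
        exact (ae_dirac_iff (measurableSet_singleton x)).2 rfl
      exact ae_of_ae_map measurable_snd.aemeasurable h
    have hDx : Measurable fun y : G => weightedEDist p y x ^ (2 : ℝ) := (hD.comp hx).pow_const _
    rw [← hγ.1, lintegral_map hDx measurable_fst]
    refine lintegral_congr_ae ?_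
    filter_upwards [hs] with z hz
    rw [hz]

end Couplings

/-! ### Laws of the iterates -/

section MarkovChain

variable {Ω : Type*} [MeasurableSpace Ω] {Pr : Measure Ω} [IsProbabilityMeasure Pr]

/-- The joint law of the triple is a product of three measures, which may be reassociated. -/
theorem indepFun_prodMk_of_indepFun_prodMk {α β γ : Type*} [MeasurableSpace α] [MeasurableSpace β]
    [MeasurableSpace γ] {A : Ω → α} {B : Ω → β} {C : Ω → γ} (hA : Measurable A) (hB : Measurable B)
    (hC : Measurable C) (h : IndepFun A (fun ω => (B ω, C ω)) Pr) (hBC : IndepFun B C Pr) :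
    IndepFun (fun ω => (A ω, B ω)) C Pr := by
  have hAB : IndepFun A B Pr := h.comp measurable_id measurable_fst
  have := Measure.isProbabilityMeasure_map (μ := Pr) hA.aemeasurable
  have := Measure.isProbabilityMeasure_map (μ := Pr) hB.aemeasurable
  have := Measure.isProbabilityMeasure_map (μ := Pr) hC.aemeasurable
  rw [indepFun_iff_map_prod_eq_prod_map_map (by fun_prop) (by fun_prop)] at h hBC hAB ⊢
  rw [hAB]
  refine MeasurableEquiv.prodAssoc.map_measurableEquiv_injective ?_
  rw [Measure.prodAssoc_prod, ← hBC, ← h,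
    Measure.map_map MeasurableEquiv.prodAssoc.measurable (by fun_prop)]
  rfl

omit [IsProbabilityMeasure Pr] in
theorem indepFun_tail {I : Type*} [MeasurableSpace I] {ξ : ℕ → Ω → I} (hξ : ∀ k, Measurable (ξ k))
    (h : iIndepFun ξ Pr) (k : ℕ) : IndepFun (ξ k) (fun ω n => ξ (k + 1 + n) ω) Pr := by
  have key := indep_iSup_of_disjoint (fun i => (hξ i).comap_le) h.iIndep
    (S := {k}) (T := Set.Ioi k) (by simp)
  refine indep_of_indep_of_le_left (indep_of_indep_of_le_right key ?_) (by simp)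
  refine Measurable.comap_le (@measurable_pi_lambda _ _ _ (_) _ _ fun n => ?_)
  refine Measurable.mono (comap_measurable (ξ (k + 1 + n))) ?_ le_rfl
  exact le_iSup₂_of_le (k + 1 + n) (by simp; omega) le_rfl

variable {m : ℕ} {E : Fin m → Type*} [∀ j, NormedAddCommGroup (E j)]
  [∀ j, MeasurableSpace (E j)] {G : Set (PiLp 2 E)} {I : Type*} [MeasurableSpace I]

namespace BlockSystem

theorem measurable_iterates (B : BlockSystem E G I) {ξ : ℕ → Ω → I} (hξ : ∀ k, Measurable (ξ k))
    {X₀ : Ω → G} (hX₀ : Measurable X₀) (k : ℕ) : Measurable (B.iterates ξ X₀ k) := by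
  induction k with
  | zero => exact hX₀
  | succ k ih => exact B.measurable_T.comp (ih.prodMk (hξ k))

/-- Independence from the whole remaining index sequence, not only from `ξ k`, is what makes the
induction close. -/
theorem indepFun_iterates (B : BlockSystem E G I) {ξ : ℕ → Ω → I} (hξ : ∀ k, Measurable (ξ k))
    (hξ_indep : iIndepFun ξ Pr) {X₀ : Ω → G} (hX₀ : Measurable X₀)
    (hX₀_indep : IndepFun X₀ (fun ω k => ξ k ω) Pr) (k : ℕ) :
    IndepFun (B.iterates ξ X₀ k) (fun ω n => ξ (k + n) ω) Pr := by
  induction k with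
  | zero => simpa [iterates] using hX₀_indep
  | succ k ih =>
    have hX := B.measurable_iterates hξ hX₀ k
    have hsplit : Measurable fun f : ℕ → I => (f 0, fun n => f (1 + n)) := by fun_prop
    have h := indepFun_prodMk_of_indepFun_prodMk hX (hξ k)
      (measurable_pi_lambda _ fun n => hξ (k + 1 + n))
      (by simpa [Function.comp_def, add_assoc] using ih.comp measurable_id hsplit)
      (indepFun_tail hξ hξ_indep k)
    exact h.comp B.measurable_T measurable_id

theorem map_iterates_succ (B : BlockSystem E G I) (η : Measure I) [IsProbabilityMeasure η]
    {ξ : ℕ → Ω → I} (hξ : ∀ k, Measurable (ξ k)) (hξ_law : ∀ k, Pr.map (ξ k) = η)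
    (hξ_indep : iIndepFun ξ Pr) {X₀ : Ω → G} (hX₀ : Measurable X₀)
    (hX₀_indep : IndepFun X₀ (fun ω k => ξ k ω) Pr) (k : ℕ) :
    Pr.map (B.iterates ξ X₀ (k + 1)) = (Pr.map (B.iterates ξ X₀ k)).bind (B.kernel η) := by
  have hX := B.measurable_iterates hξ hX₀ k
  have hind : IndepFun (B.iterates ξ X₀ k) (ξ k) Pr :=
    (B.indepFun_iterates hξ hξ_indep hX₀ hX₀_indep k).comp measurable_id (measurable_pi_apply 0)
  have hlaw := (indepFun_iff_map_prod_eq_prod_map_map hX.aemeasurable (hξ k).aemeasurable).1 hind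
  rw [hξ_law] at hlaw
  have hstep : B.iterates ξ X₀ (k + 1) =
      (fun z : G × I => B.T z.2 z.1) ∘ fun ω => (B.iterates ξ X₀ k ω, ξ k ω) := rfl
  rw [hstep, ← Measure.map_map B.measurable_T (hX.prodMk (hξ k)), hlaw]
  refine Measure.ext_of_lintegral _ fun f hf => ?_
  rw [lintegral_map hf B.measurable_T,
    Measure.lintegral_bind (B.kernel η).measurable.aemeasurable hf.aemeasurable,
    lintegral_prod (fun z : G × I => f (B.T z.2 z.1)) (hf.comp B.measurable_T).aemeasurable]
  refine lintegral_congr fun x => ?_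
  exact (lintegral_map hf (B.measurable_T.comp measurable_prodMk_left)).symm

end BlockSystem

end MarkovChain

/-! ### Scalar recursions governed by the rate -/

section Rate

variable {θ : ℝ≥0 → ℝ≥0} {tbar : ℝ≥0}

theorem IsRate.le_self (h : IsRate θ tbar) {t : ℝ≥0} (ht : t < tbar) : θ t ≤ t := by
  rcases eq_or_ne t 0 with rfl | h0
  · exact h.2.1.le
  · exact (h.2.2.2 t (pos_iff_ne_zero.2 h0) ht).2

/-- The sequence decreases to some `L`, and continuity makes `L` a fixed point of `θ`; the iterates
at `L` are constant, so `L = 0`. Monotonicity of `θ` plays no role. -/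
theorem IsRate.tendsto_zero_of_le (h : IsRate θ tbar)
    (hθ : ∀ t, 0 < t → t < tbar → Tendsto (fun k : ℕ => θ^[k] t) atTop (𝓝 0))
    {s : ℕ → ℝ≥0} (hs₀ : s 0 < tbar) (hs : ∀ k, s (k + 1) ≤ θ (s k)) :
    Tendsto s atTop (𝓝 0) := by
  have hlt : ∀ k, s k < tbar := by
    intro k
    induction k with
    | zero => exact hs₀
    | succ k ih => exact ((hs k).trans (h.le_self ih)).trans_lt ih
  have hanti : Antitone s := antitone_nat_of_succ_le fun k => (hs k).trans (h.le_self (hlt k))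
  have hlim := tendsto_atTop_ciInf hanti (OrderBot.bddBelow _)
  set L := ⨅ k, s k
  have hLt : L < tbar := (ciInf_le (OrderBot.bddBelow _) 0).trans_lt hs₀
  have hL : L ≤ θ L :=
    le_of_tendsto_of_tendsto' (hlim.comp (tendsto_add_atTop_nat 1))
      ((h.1.tendsto L).comp hlim) hs
  rcases eq_or_ne L 0 with h0 | h0
  · rwa [h0] at hlim
  · have hfix : Function.IsFixedPt θ L := le_antisymm (h.le_self hLt) hL
    have hc := hθ L (pos_iff_ne_zero.2 h0) hLt
    simp only [(hfix.iterate _).eq] at hc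
    exact absurd (tendsto_nhds_unique tendsto_const_nhds hc) h0

theorem IsRate.le_iterate (h : IsRate θ tbar) {s : ℕ → ℝ≥0} (hs₀ : s 0 < tbar)
    (hs : ∀ k, s (k + 1) ≤ θ (s k)) (hm : MonotoneOn θ (Set.Icc 0 (s 0))) (k : ℕ) :
    s k ≤ θ^[k] (s 0) := by
  -- The second bound keeps the iterates in the interval on which `θ` is monotone.
  suffices s k ≤ θ^[k] (s 0) ∧ θ^[k] (s 0) ≤ s 0 from this.1
  induction k with
  | zero => simp
  | succ k ih =>
    rw [Function.iterate_succ_apply']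
    exact ⟨(hs k).trans (hm ⟨zero_le, ih.1.trans ih.2⟩ ⟨zero_le, ih.2⟩ ih.1),
      (h.le_self (ih.2.trans_lt hs₀)).trans ih.2⟩

theorem SummableIterates.tendsto_zero (h : SummableIterates θ tbar) {t : ℝ≥0} (h0 : 0 < t)
    (ht : t < tbar) : Tendsto (fun k : ℕ => θ^[k] t) atTop (𝓝 0) :=
  (tendsto_add_atTop_iff_nat 1).1 (NNReal.tendsto_atTop_zero_of_summable (h t h0 ht))

theorem SummableIterates.summable (h : SummableIterates θ tbar) (hθ : θ 0 = 0) {t : ℝ≥0}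
    (ht : t < tbar) (k : ℕ) : Summable fun j : ℕ => θ^[k + j] t := by
  have hsum : Summable fun j : ℕ => θ^[j] t := by
    rcases eq_or_ne t 0 with rfl | h0
    · simp [Function.iterate_fixed hθ]
    · exact (NNReal.summable_nat_add_iff 1).1 (h t (pos_iff_ne_zero.2 h0) ht)
  simpa only [add_comm k] using (NNReal.summable_nat_add_iff k).2 hsum

end Rate

/-! ### Fejér monotone sequences -/

section Fejer

variable {m : ℕ} {E : Fin m → Type*} [∀ j, NormedAddCommGroup (E j)]
  [∀ j, MeasurableSpace (E j)] [∀ j, BorelSpace (E j)] [∀ j, SecondCountableTopology (E j)]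
  {G : Set (PiLp 2 E)} [CompactSpace G] {p : Fin m → ℝ}

omit [∀ j, BorelSpace (E j)] [∀ j, SecondCountableTopology (E j)] [CompactSpace G] in
theorem le_two_mul_wassersteinInf {μ : ProbabilityMeasure G} {S : Set (ProbabilityMeasure G)}
    {r : ℝ≥0∞} (h : ∀ ν ∈ S, r ≤ wasserstein p μ ν + wasserstein p μ ν) :
    r ≤ 2 * wassersteinInf p μ S := by
  simp_rw [wassersteinInf, ENNReal.mul_iInf_of_ne two_ne_zero ENNReal.ofNat_ne_top, two_mul]
  exact le_iInf₂ h

/-- A sequence that is Fejér monotone with respect to `S` has a cluster point whose distance to the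
iterates is controlled by their distances to `S`. -/
theorem exists_wasserstein_le_of_fejer (hp : ∀ j, 0 < p j) {S : Set (ProbabilityMeasure G)}
    {μ : ℕ → ProbabilityMeasure G}
    (hμ : ∀ k, ∀ ν ∈ S, wasserstein p (μ (k + 1)) ν ≤ wasserstein p (μ k) ν) :
    ∃ π : ProbabilityMeasure G, ∀ k, wasserstein p (μ k) π ≤ 2 * wassersteinInf p (μ k) S := by
  obtain ⟨π, -, hπ⟩ := isCompact_univ.ultrafilter_le_nhds
    ((Ultrafilter.of (atTop : Filter ℕ)).map μ) (by simp)
  have hπ : Tendsto μ (Ultrafilter.of (atTop : Filter ℕ)) (𝓝 π) := hπ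
  refine ⟨π, fun k => wasserstein_le_of_tendsto p hπ ?_⟩
  -- Both `μ k` and every later `μ l` lie within `W(μ k, ν)` of `ν`; this is the source of the
  -- factor `2`.
  filter_upwards [(Ultrafilter.of_le atTop) (eventually_ge_atTop k)] with l hl
  refine le_two_mul_wassersteinInf fun ν hν => (wasserstein_triangle hp _ ν _).trans ?_
  gcongr
  rw [wasserstein_comm]
  exact antitone_nat_of_succ_le (f := fun i => wasserstein p (μ i) ν) (fun i => hμ i ν hν) hl

end Fejer

/-! ### Invariant measures and common fixed points -/

namespace BlockSystem

variable {m : ℕ} {E : Fin m → Type*} [∀ j, NormedAddCommGroup (E j)]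
  [∀ j, MeasurableSpace (E j)] [∀ j, BorelSpace (E j)] [∀ j, SecondCountableTopology (E j)]
  {G : Set (PiLp 2 E)} [CompactSpace G] {p : Fin m → ℝ} {I : Type*} [MeasurableSpace I]
  {B : BlockSystem E G I} {η : Measure I} [IsProbabilityMeasure η]

omit [∀ j, BorelSpace (E j)] [∀ j, SecondCountableTopology (E j)] in
theorem IsParacontraction.wasserstein_markov_le (hB : B.IsParacontraction η p)
    {π : ProbabilityMeasure G} (hπ : π ∈ B.inv η) (μ : ProbabilityMeasure G) :
    wasserstein p (B.markov η μ) π ≤ wasserstein p μ π := by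
  by_cases hμ : μ ∈ B.inv η
  · rw [show B.markov η μ = μ from hμ]
  · exact (hB.2 π hπ μ ⟨mem_secondMomentMeasures p μ, hμ⟩).le

/-- Nonexpansiveness towards a nearby invariant `ν` gives `W(μP, μ) ≤ 2 W(μ, ν)`; neither continuity
of the `T_i` nor a nearest `ν` is needed. -/
theorem IsParacontraction.mem_inv (hp : ∀ j, 0 < p j) (hB : B.IsParacontraction η p)
    {μ : ProbabilityMeasure G} (hμ : wassersteinInf p μ (B.inv η) = 0) : μ ∈ B.inv η := by
  have h : wasserstein p (B.markov η μ) μ ≤ 2 * wassersteinInf p μ (B.inv η) := by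
    refine le_two_mul_wassersteinInf fun ν hν => (wasserstein_triangle hp _ ν _).trans ?_
    exact add_le_add (hB.wasserstein_markov_le hν μ) (wasserstein_comm p ν μ).le
  rw [hμ, mul_zero, nonpos_iff_eq_zero] at h
  exact eq_of_wasserstein_eq_zero hp h

omit [∀ j, BorelSpace (E j)] [∀ j, SecondCountableTopology (E j)] [CompactSpace G] in
theorem mem_commonFix_iff [MeasurableSingletonClass G] [MeasurableSingletonClass I]
    [Countable I] {x : G} : x ∈ B.commonFix η ↔ B.kernel η x = Measure.dirac x := by
  have hT : Measurable fun i => B.T i x := B.measurable_T.comp measurable_prodMk_left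
  have hk : B.kernel η x = η.map fun i => B.T i x := rfl
  have := Measure.isProbabilityMeasure_map (μ := η) hT.aemeasurable
  have hset : MeasurableSet {i | x = B.T i x} := Set.to_countable _ |>.measurableSet
  have hfix : x ∈ B.commonFix η ↔ ∀ᵐ i ∂η, B.T i x = x := by
    simp only [commonFix, Set.mem_ofPred_eq, ← prob_compl_eq_zero_iff hset, ae_iff]
    simp only [Set.compl_ofPred, eq_comm]
  rw [hfix, hk]
  constructor
  · intro h
    rw [Measure.map_congr h, Measure.map_const, measure_univ, one_smul]
  · intro h
    have : ∀ᵐ y ∂η.map fun i => B.T i x, y = x := by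
      rw [h]
      exact (ae_dirac_iff (measurableSet_singleton x)).2 rfl
    exact ae_of_ae_map hT.aemeasurable this

omit [∀ j, BorelSpace (E j)] [∀ j, SecondCountableTopology (E j)] [CompactSpace G] in
theorem diracProbability_mem_inv [MeasurableSingletonClass G] [MeasurableSingletonClass I]
    [Countable I] {x : G} : diracProbability x ∈ B.inv η ↔ x ∈ B.commonFix η := by
  have hd : ((B.markov η (diracProbability x) : ProbabilityMeasure G) : Measure G) =
      B.kernel η x := Measure.dirac_bind (B.kernel η).measurable x
  rw [mem_commonFix_iff, ← hd]
  exact Subtype.ext_iff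

omit [CompactSpace G] in
theorem wasserstein_dirac_dirac (p : Fin m → ℝ) (x y : G) :
    wasserstein p (diracProbability x) (diracProbability y) = weightedEDist p x y := by
  have hm : Measurable fun z : G => weightedEDist p z y ^ (2 : ℝ) :=
    ((measurable_weightedEDist p).comp
      (by fun_prop : Measurable fun z : G => (z, y))).pow_const _
  rw [wasserstein_dirac]
  change (∫⁻ z, weightedEDist p z y ^ (2 : ℝ) ∂(Measure.dirac x)) ^ (1 / 2 : ℝ) = _
  rw [lintegral_dirac' _ hm, ← ENNReal.rpow_mul]
  simp

/-- The `T_i` need not be continuous. Dirac masses embed `G` isometrically and carry `C` into `inv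
P`, so `mem_inv` applies to a limit of points of `C`. -/
theorem IsParacontraction.isClosed_commonFix [MeasurableSingletonClass I] [Countable I]
    (hp : ∀ j, 0 < p j) (hB : B.IsParacontraction η p) : IsClosed (B.commonFix η) := by
  refine isClosed_of_closure_subset fun y hy => ?_
  rw [← diracProbability_mem_inv]
  refine hB.mem_inv hp (le_antisymm (le_of_forall_gt fun r hr => ?_) zero_le)
  have hd : Continuous fun z : G => weightedEDist p y z :=
    Continuous.comp (g := fun z : G × G => weightedEDist p z.1 z.2) (f := fun z : G => (y, z))
      (continuous_weightedEDist p) (by fun_prop)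
  obtain ⟨z, hz, hzC⟩ := mem_closure_iff.1 hy _ (isOpen_Iio.preimage hd)
    (show weightedEDist p y y < r by rwa [(weightedEDist_eq_zero hp).2 rfl])
  exact (iInf₂_le _ (diracProbability_mem_inv.2 hzC)).trans_lt
    ((wasserstein_dirac_dirac p y z).trans_lt hz)

theorem IsParacontraction.support_subset_commonFix [MeasurableSingletonClass I] [Countable I]
    (hp : ∀ j, 0 < p j) (hB : B.IsParacontraction η p) (hC : (B.commonFix η).Nonempty)
    {π : ProbabilityMeasure G} (hπ : π ∈ B.inv η) :
    (π : Measure G).support ⊆ B.commonFix η := by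
  obtain ⟨x, hx⟩ := hC
  have hm : Measurable fun z : G => weightedEDist p z x ^ (2 : ℝ) :=
    ((measurable_weightedEDist p).comp
      (by fun_prop : Measurable fun z : G => (z, x))).pow_const _
  have hmarkov : ∀ μ : ProbabilityMeasure G,
      ∫⁻ z, weightedEDist p z x ^ (2 : ℝ) ∂(B.markov η μ : Measure G) =
        ∫⁻ y, ∫⁻ z, weightedEDist p z x ^ (2 : ℝ) ∂(B.kernel η y) ∂(μ : Measure G) := fun μ =>
    Measure.lintegral_bind (B.kernel η).measurable.aemeasurable hm.aemeasurable
  have hPm : Measurable fun y => ∫⁻ z, weightedEDist p z x ^ (2 : ℝ) ∂(B.kernel η y) :=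
    hm.lintegral_kernel
  -- The paracontraction inequality for the Dirac masses at `y` and `x`.
  have hlt : ∀ y, y ∉ B.commonFix η →
      ∫⁻ z, weightedEDist p z x ^ (2 : ℝ) ∂(B.kernel η y) < weightedEDist p y x ^ (2 : ℝ) := by
    intro y hy
    have h := hB.2 _ (diracProbability_mem_inv.2 hx) _
      ⟨mem_secondMomentMeasures p (diracProbability y), mt diracProbability_mem_inv.1 hy⟩
    rw [wasserstein_dirac, wasserstein_dirac, hmarkov] at h
    change (∫⁻ w, ∫⁻ z, weightedEDist p z x ^ (2 : ℝ) ∂(B.kernel η w) ∂(Measure.dirac y)) ^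
      (1 / 2 : ℝ) < (∫⁻ w, weightedEDist p w x ^ (2 : ℝ) ∂(Measure.dirac y)) ^ (1 / 2 : ℝ) at h
    rw [lintegral_dirac' _ hPm, lintegral_dirac' _ hm] at h
    exact (ENNReal.rpow_lt_rpow_iff (by norm_num)).1 h
  have hle : ∀ y, ∫⁻ z, weightedEDist p z x ^ (2 : ℝ) ∂(B.kernel η y) ≤
      weightedEDist p y x ^ (2 : ℝ) := by
    intro y
    by_cases hy : y ∈ B.commonFix η
    · rw [mem_commonFix_iff.1 hy, lintegral_dirac' _ hm]
    · exact (hlt y hy).le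
  have heq := hmarkov π
  rw [show B.markov η π = π from hπ] at heq
  -- By invariance both sides of `hle` have the same finite integral, so they agree almost
  -- everywhere.
  have hae := ae_eq_of_ae_le_of_lintegral_le (ae_of_all (π : Measure G) hle)
    (heq ▸ lintegral_weightedEDist_ne_top p x _) hm.aemeasurable heq.le
  refine Measure.support_subset_of_isClosed (hB.isClosed_commonFix hp) ?_
  filter_upwards [hae] with y hy
  by_contra h
  exact (hlt y h).ne hy

end BlockSystem

/-! ### The convergence theorem -/

theorem proposition4p3 {m : ℕ} {E : Fin m → Type*}
    [∀ j, NormedAddCommGroup (E j)] [∀ j, InnerProductSpace ℝ (E j)]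
    [∀ j, FiniteDimensional ℝ (E j)] [∀ j, MeasurableSpace (E j)] [∀ j, BorelSpace (E j)]
    {G : Set (PiLp 2 E)} (hG : IsCompact G)
    {I : Type*} [Fintype I] [MeasurableSpace I] [MeasurableSingletonClass I]
    (B : BlockSystem E G I)
    -- the law of the random index and the probability space
    (η : Measure I) [IsProbabilityMeasure η]
    {Ω : Type*} [MeasurableSpace Ω] (Pr : Measure Ω) [IsProbabilityMeasure Pr]
    -- the i.i.d. indices and the independent initial point
    (ξ : ℕ → Ω → I) (hξ : ∀ k, Measurable (ξ k)) (hξ_law : ∀ k, Pr.map (ξ k) = η)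
    (hξ_indep : iIndepFun ξ Pr)
    (X₀ : Ω → G) (hX₀ : Measurable X₀) (hX₀_indep : IndepFun X₀ (fun ω k => ξ k ω) Pr)
    -- the weights of the norm
    (p : Fin m → ℝ) (hp : ∀ j, p j = B.blockProb η j) (hp_pos : ∀ j, 0 < p j)
    (hB : B.IsParacontraction η p)
    -- the distributions of the iterates
    (μ : ℕ → ProbabilityMeasure G) (hμ : ∀ k, (μ k : Measure G) = Pr.map (B.iterates ξ X₀ k))
    (hμ₀ : μ 0 ∈ secondMomentMeasures p)
    (θ : ℝ≥0 → ℝ≥0) (tbar : ℝ≥0) (hmono : IsGaugeMonotone p θ tbar (B.inv η) μ)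
    (t₀ : ℝ≥0) (ht₀ : (t₀ : ℝ≥0∞) = wassersteinInf p (μ 0) (B.inv η))
    (hab : VanishingAndFejer p θ tbar (B.inv η) μ ∨ SummableIterates θ tbar) :
    ∃ π ∈ B.inv η ∩ secondMomentMeasures p,
      ConvergesGaugeMonotonically p θ tbar (B.inv η) μ π ∧
      (MonotoneOn θ (Set.Icc 0 t₀) →
        (VanishingAndFejer p θ tbar (B.inv η) μ →
          ∃ c : ℝ≥0, ∀ k : ℕ, wasserstein p (μ k) π ≤ c * (θ^[k] t₀ : ℝ≥0)) ∧
        (SummableIterates θ tbar →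
          ∃ c : ℝ≥0, ∀ k : ℕ,
            wasserstein p (μ k) π ≤ c * (∑' j : ℕ, θ^[k + j] t₀ : ℝ≥0))) ∧
      ((B.commonFix η).Nonempty → (π : Measure G).support ⊆ B.commonFix η) := by
  have : CompactSpace G := isCompact_iff_compactSpace.1 hG
  have : ∀ j, SecondCountableTopology (E j) := fun j => by
    have := FiniteDimensional.proper ℝ (E j)
    infer_instance
  have hsucc : ∀ k, μ (k + 1) = B.markov η (μ k) := fun k => Subtype.ext <| by
    change (μ (k + 1) : Measure G) = (μ k : Measure G).bind (B.kernel η)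
    rw [hμ, hμ]
    exact B.map_iterates_succ η hξ hξ_law hξ_indep hX₀ hX₀_indep k
  obtain ⟨π, hπ⟩ := exists_wasserstein_le_of_fejer hp_pos (S := B.inv η) (μ := μ) fun k ν hν =>
    hsucc k ▸ hB.wasserstein_markov_le hν (μ k)
  obtain ⟨hrate, hlt, hstep⟩ := hmono
  set s : ℕ → ℝ≥0 := fun k => (wassersteinInf p (μ k) (B.inv η)).toNNReal with hs
  -- `toNNReal` sends `∞` to `0`, so finiteness is needed before `s` stands for the true distances.
  have hfin : ∀ k, (s k : ℝ≥0∞) = wassersteinInf p (μ k) (B.inv η) := by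
    refine fun k => ENNReal.coe_toNNReal ?_
    cases k with
    | zero => exact hlt.ne_top
    | succ k => exact ne_top_of_le_ne_top ENNReal.coe_ne_top (hstep k)
  have hs_step : ∀ k, s (k + 1) ≤ θ (s k) := fun k =>
    ENNReal.coe_le_coe.1 ((hfin (k + 1)).trans_le (hstep k))
  have hs₀ : s 0 = t₀ := ENNReal.coe_injective ((hfin 0).trans ht₀.symm)
  have hs₀_lt : s 0 < tbar := ENNReal.coe_lt_coe.1 ((hfin 0).trans_lt hlt)
  have hθ : ∀ t, 0 < t → t < tbar → Tendsto (fun k : ℕ => θ^[k] t) atTop (𝓝 0) :=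
    hab.elim (fun h => h.1) fun h _ h0 ht => h.tendsto_zero h0 ht
  have hbound : ∀ k, wasserstein p (μ k) π ≤ ((2 : ℝ≥0) : ℝ≥0∞) * (s k : ℝ≥0∞) := fun k =>
    (hπ k).trans_eq (by rw [hfin]; rfl)
  have hs_lim : Tendsto (fun k => (s k : ℝ≥0∞)) atTop (𝓝 0) :=
    ENNReal.tendsto_coe.2 (hrate.tendsto_zero_of_le hθ hs₀_lt hs_step)
  have hlim : Tendsto (fun k => wasserstein p (μ k) π) atTop (𝓝 0) := by
    have h := ENNReal.Tendsto.const_mul hs_lim (Or.inr (ENNReal.coe_ne_top (r := 2)))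
    rw [mul_zero] at h
    exact tendsto_of_tendsto_of_tendsto_of_le_of_le tendsto_const_nhds h (fun _ => zero_le) hbound
  -- `d(π, inv P) ≤ W(μ k, π) + s k`, and the right side tends to `0`.
  have hπ_inv : π ∈ B.inv η := by
    refine hB.mem_inv hp_pos (nonpos_iff_eq_zero.1 ?_)
    have h := hlim.add hs_lim
    rw [add_zero] at h
    refine ge_of_tendsto' h fun k => ?_
    rw [hfin, wassersteinInf, wassersteinInf, ENNReal.add_iInf₂]
    refine iInf₂_mono fun ν _ => ?_
    rw [wasserstein_comm p (μ k) π]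
    exact wasserstein_triangle hp_pos π (μ k) ν
  refine ⟨π, ⟨hπ_inv, mem_secondMomentMeasures p π⟩, ⟨hlim, hrate, hlt, hstep⟩, fun hm => ?_,
    fun hC => hB.support_subset_commonFix hp_pos hC hπ_inv⟩
  have hiter : ∀ k, s k ≤ θ^[k] t₀ := fun k =>
    hs₀ ▸ hrate.le_iterate hs₀_lt hs_step (hs₀ ▸ hm) k
  refine ⟨fun _ => ⟨2, fun k => (hbound k).trans ?_⟩,
    fun hsum => ⟨2, fun k => (hbound k).trans ?_⟩⟩
  · gcongr
    exact hiter k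
  · gcongr
    -- The term `j = 0` of the tail sum is already `θ^[k] t₀`.
    exact (hiter k).trans
      ((hsum.summable hrate.2.1 (hs₀ ▸ hs₀_lt) k).le_tsum 0 fun _ _ => zero_le)
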